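/- All lattices are nonempty. A finite lattice is called planar if it has a planar Hasse diagram, i.e. if its elements can be represented by distinct points of the plane such that $x<y$ implies that the point of $x$ lies strictly lower than the point of $y$, and such that the straight line segments drawn between the points of $x$ and $y$ for all covering pairs $x\prec y$ contain no point of an element other than their two endpoints and pairwise intersect at most in common endpoints; planar lattices are finite by definition. A lattice homomorphism $f\colon A\to B$ between finite lattices is a cover-preserving $\{0,1\}$-homomorphism if $f(0)=0$, $f(1)=1$, and $x\prec y$ implies $f(x)\prec f(y)$ for all $x,y\in A$. Let $\mathcal X$ be a category whose objects are lattices and whose morphisms are (some, not necessarily all) lattice homomorphisms among them, and let $A$ be an object of $\mathcal X$. An $\mathcal X$-extension of $A$ is an object $B$ of $\mathcal X$ that contains $A$ as a sublattice (up to isomorphism, i.e. via an embedding of $A$ into $B$) such that the inclusion map $A\to B$ is a morphism of $\mathcal X$. A retraction $B\to A$ is a lattice homomorphism $f\colon B\to A$ such that $f(a)=a$ for all $a\in A$. The lattice $A$ is an absolute retract for $\mathcal X$ if for every $\mathcal X$-extension $B$ of $A$ there exists a retraction $B\to A$ that is a morphism of $\mathcal X$; and $A$ is an absolute H-retract for $\mathcal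 X$ if for every $\mathcal X$-extension $B$ of $A$ there exists a retraction $B\to A$ (which need not be a morphism of $\mathcal X$). **Corollary.** If $D$ is a planar distributive lattice, then the following four conditions are equivalent. 1. $D$ is an absolute retract for the class of planar distributive lattices with all lattice homomorphisms as morphisms. 2. $D$ is an absolute H-retract for the category of planar distributive lattices with cover-preserving $\{0,1\}$-homomorphisms as morphisms. 3. $D$ is an absolute retract for the category of planar distributive lattices with cover-preserving $\{0,1\}$-homomorphisms as morphisms. 4. $|D|\le 2$ or $D$ is (isomorphic to) the direct product of two finite chains, each having more than one element. -/

import Mathlib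

universe u

/-- `p` places the elements of the poset `L` as points of the plane in such a way that drawing the
straight line segment from `p x` to `p y` for every covering pair `x ⋖ y` yields a planar Hasse
diagram of `L`: distinct elements are placed at distinct points, larger elements are placed higher,
an edge passes through no element other than its two endpoints, and two different edges meet at
most in a common endpoint. -/
structure IsPlanarDiagram {L : Type u} [PartialOrder L] (p : L → ℝ × ℝ) : Prop where
  injective : Function.Injective p
  upward : ∀ x y : L, x < y → (p x).2 < (p y).2
  vertex_edge : ∀ x y z : L, x ⋖ y → p z ∈ segment ℝ (p x) (p y) → z = x ∨ z = y
  edge_edge : ∀ x y x' y' : L, x ⋖ y → x' ⋖ y' → (x, y) ≠ (x', y') →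
    ∀ q : ℝ × ℝ, q ∈ segment ℝ (p x) (p y) → q ∈ segment ℝ (p x') (p y') →
      (q = p x ∨ q = p y) ∧ (q = p x' ∨ q = p y')

/-- A planar lattice: a finite (nonempty) lattice that has a planar Hasse diagram. -/
structure IsPlanarLattice (L : Type u) [Lattice L] : Prop where
  finite : Finite L
  nonempty : Nonempty L
  diagram : ∃ p : L → ℝ × ℝ, IsPlanarDiagram p

theorem IsPlanarLattice.of_orderIso {A B : Type u} [Lattice A] [Lattice B] (e : A ≃o B)
    (hA : IsPlanarLattice A) : IsPlanarLattice B := by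
  obtain ⟨hfin, hne, p, hp⟩ := hA
  have hcov : ∀ x y : B, x ⋖ y → e.symm x ⋖ e.symm y := fun x y h =>
    (apply_covBy_apply_iff e.symm).2 h
  refine ⟨Finite.of_equiv A e.toEquiv, hne.map e, fun b => p (e.symm b), ?_, ?_, ?_, ?_⟩
  · exact hp.injective.comp e.symm.injective
  · exact fun x y h => hp.upward _ _ (e.symm.strictMono h)
  · intro x y z h hz
    simpa using hp.vertex_edge _ _ _ (hcov x y h) hz
  · intro x y x' y' h h' hne' q hq hq'
    refine hp.edge_edge _ _ _ _ (hcov x y h) (hcov x' y' h') ?_ q hq hq'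
    intro heq
    apply hne'
    simpa using heq

/-- A (concrete) category of distributive lattices: a class of distributive lattices, closed under
isomorphism, together with a class of lattice homomorphisms (the morphisms) among its objects that
contains the identities and is closed under composition. Not every lattice homomorphism between
objects needs to be a morphism. -/
structure DistLatCategory where
  Obj : ∀ (L : Type u) [DistribLattice L], Prop
  Mor : ∀ {A B : Type u} [DistribLattice A] [DistribLattice B], LatticeHom A B → Prop
  obj_of_orderIso : ∀ {A B : Type u} [DistribLattice A] [DistribLattice B], A ≃o B → Obj A → Obj B
  mor_id : ∀ (A : Type u) [DistribLattice A], Obj A → Mor (LatticeHom.id A)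
  mor_comp : ∀ {A B C : Type u} [DistribLattice A] [DistribLattice B] [DistribLattice C]
    (g : LatticeHom B C) (f : LatticeHom A B), Obj A → Obj B → Obj C →
      Mor g → Mor f → Mor (g.comp f)

namespace DistLatCategory

/-- `B` is an extension of `A` in the category `X`, by means of the embedding `ι`: the lattice `B`
is an object of `X` and the embedding `ι` of `A` into `B` is a morphism of `X`. -/
def IsExtension (X : DistLatCategory.{u}) {A B : Type u} [DistribLattice A] [DistribLattice B]
    (ι : LatticeHom A B) : Prop :=
  X.Obj A ∧ X.Obj B ∧ Function.Injective ι ∧ X.Mor ι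

/-- `A` is an absolute retract for the category `X`: for every extension `B` of `A` in `X` there is
a retraction of `B` onto `A` among the morphisms of `X`. -/
def IsAbsoluteRetract (X : DistLatCategory.{u}) (A : Type u) [DistribLattice A] : Prop :=
  X.Obj A ∧ ∀ (B : Type u) [DistribLattice B] (ι : LatticeHom A B), X.IsExtension ι →
    ∃ f : LatticeHom B A, X.Mor f ∧ ∀ a : A, f (ι a) = a

/-- `A` is an absolute H-retract for the category `X`: for every extension `B` of `A` in `X` there
is a retraction of `B` onto `A`, that is, a lattice homomorphism, not necessarily a morphism of `X`,
that fixes the elements of `A`. -/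
def IsAbsoluteHRetract (X : DistLatCategory.{u}) (A : Type u) [DistribLattice A] : Prop :=
  X.Obj A ∧ ∀ (B : Type u) [DistribLattice B] (ι : LatticeHom A B), X.IsExtension ι →
    ∃ f : LatticeHom B A, ∀ a : A, f (ι a) = a

end DistLatCategory

/-- Cover-preserving {0,1}-homomorphisms (between finite lattices): the least element is mapped to
the least element, the greatest element to the greatest element, and coverings to coverings. -/
structure IsCoverPreservingZeroOneHom {A B : Type u} [Lattice A] [Lattice B]
    (f : LatticeHom A B) : Prop where
  map_zero : ∀ a : A, IsBot a → IsBot (f a)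
  map_one : ∀ a : A, IsTop a → IsTop (f a)
  map_covBy : ∀ a b : A, a ⋖ b → f a ⋖ f b

/-- The class of planar distributive lattices with all homomorphisms. -/
def planarDistLat : DistLatCategory.{u} where
  Obj := fun L _ => IsPlanarLattice L
  Mor := fun _ => True
  obj_of_orderIso := fun e h => h.of_orderIso e
  mor_id := fun _ _ _ => trivial
  mor_comp := fun _ _ _ _ _ _ _ => trivial

/-- The category of planar distributive lattices with cover-preserving {0,1}-homomorphisms. -/
def planarDistLatCov : DistLatCategory.{u} where
  Obj := fun L _ => IsPlanarLattice L
  Mor := fun f => IsCoverPreservingZeroOneHom f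
  obj_of_orderIso := fun e h => h.of_orderIso e
  mor_id := fun _ _ _ => ⟨fun _ h => h, fun _ h => h, fun _ _ h => h⟩
  mor_comp := fun _ _ _ _ _ hg hf =>
    ⟨fun a h => hg.map_zero _ (hf.map_zero a h), fun a h => hg.map_one _ (hf.map_one a h),
      fun a b h => hg.map_covBy _ _ (hf.map_covBy a b h)⟩

/-- `L` is (isomorphic to) the direct product of two finite chains with more than one element. -/
def IsProductOfTwoNontrivialFiniteChains (L : Type u) [Lattice L] : Prop :=
  ∃ (C₁ C₂ : Type u) (_ : LinearOrder C₁) (_ : LinearOrder C₂),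
    Finite C₁ ∧ Finite C₂ ∧ Nontrivial C₁ ∧ Nontrivial C₂ ∧ Nonempty (L ≃o C₁ × C₂)

/-! The implications run 1 → 3 → 2 → 4 → 1, and planarity enters through one fact: the join-prime
elements of a planar distributive lattice contain no antichain of three elements
(`IsPlanarLattice.not_supPrime_antichain`). Such an antichain would produce an element with three
upper covers, and the cube above it cannot be drawn (`not_three_covBy`).

For 2 → 4, the join-primes of a lattice with more than two elements split into two nonempty chains.
Sending `d` to the join-primes below it in each chain embeds the lattice, preserving covers, 0 and
1, into a product of two nontrivial finite chains (`exists_coverPreserving_embedding`), which is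
planar (`isPlanarLattice_prod`). A retraction of such an extension is injective
(`injective_of_leftInverse`), so the lattice is that product. The same rigidity gives 1 → 3: the
retraction is an isomorphism, hence a morphism.

For 4 → 1, let `C₁ × C₂` lie in a planar `B`. A chain of join-primes of `B` defines a homomorphism
to a chain. Join-primes separating the successive elements of `C₁` are all incomparable to one
join-prime coming from `C₂`; as there is no 3-antichain, they form a chain
(`exists_latticeHom_fst`). Doing this for both factors gives the retraction. A two-element lattice
needs just one separating join-prime. -/

open Set

/-! ### Paths of edges in a planar diagram -/

section Geometry

/-- The horizontal coordinate, at height `y`, of the straight line through `P` and `Q`. -/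
noncomputable def lineAt (P Q : ℝ × ℝ) (y : ℝ) : ℝ :=
  P.1 + (Q.1 - P.1) / (Q.2 - P.2) * (y - P.2)

theorem lineAt_left (P Q : ℝ × ℝ) : lineAt P Q P.2 = P.1 := by simp [lineAt]

theorem lineAt_right {P Q : ℝ × ℝ} (h : P.2 < Q.2) : lineAt P Q Q.2 = Q.1 := by
  have : Q.2 - P.2 ≠ 0 := (sub_pos.2 h).ne'
  simp only [lineAt]
  field_simp
  ring

theorem continuous_lineAt (P Q : ℝ × ℝ) : Continuous (lineAt P Q) := by
  unfold lineAt
  fun_prop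

theorem lineAt_mem_segment {P Q : ℝ × ℝ} (h : P.2 < Q.2) {y : ℝ} (hy : y ∈ Icc P.2 Q.2) :
    (lineAt P Q y, y) ∈ segment ℝ P Q := by
  have h0 : 0 < Q.2 - P.2 := sub_pos.2 h
  rw [segment_eq_image']
  refine ⟨(y - P.2) / (Q.2 - P.2), ⟨div_nonneg (sub_nonneg.2 hy.1) h0.le, ?_⟩, ?_⟩
  · rw [div_le_one h0]
    linarith [hy.2]
  · ext
    · simp only [lineAt, Prod.fst_add, Prod.smul_fst, Prod.fst_sub, smul_eq_mul]
      ring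
    · simp only [Prod.snd_add, Prod.smul_snd, Prod.snd_sub, smul_eq_mul]
      field_simp
      ring

theorem lt_of_forall_ne_of_lt {f g : ℝ → ℝ} (hf : Continuous f) (hg : Continuous g) {s t : ℝ}
    (hst : s ≤ t) (hs : f s < g s) (hne : ∀ y ∈ Icc s t, f y ≠ g y) : f t < g t := by
  by_contra! ht
  obtain ⟨y, hy, h0⟩ := intermediate_value_Icc' hst (hg.sub hf).continuousOn
    (show (0 : ℝ) ∈ Icc (g t - f t) (g s - f s) from ⟨by linarith, by linarith⟩)
  exact hne y hy (sub_eq_zero.1 h0).symm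

/-- The (inverse) slope of the edge from `x` to `a`. -/
noncomputable def edgeSlope {L : Type u} (p : L → ℝ × ℝ) (x a : L) : ℝ :=
  ((p a).1 - (p x).1) / ((p a).2 - (p x).2)

theorem lineAt_lt_lineAt {L : Type u} {p : L → ℝ × ℝ} {x a b : L} (h : edgeSlope p x a < edgeSlope p x b) {y : ℝ}
    (hy : (p x).2 < y) : lineAt (p x) (p a) y < lineAt (p x) (p b) y := by
  have : 0 < y - (p x).2 := sub_pos.2 hy
  simp only [lineAt]
  have := mul_lt_mul_of_pos_right h this
  simp only [edgeSlope] at this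
  linarith

variable {L : Type u} [PartialOrder L] {p : L → ℝ × ℝ}

/-- `g` describes, as a function of the height, a path of edges of the diagram `p` that goes from
`x` upward to `b` and whose vertices other than `x` belong to `W`. -/
structure IsTrace (p : L → ℝ × ℝ) (x : L) (W : Set L) (b : L) (g : ℝ → ℝ) : Prop where
  continuous : Continuous g
  map_end : g (p b).2 = (p b).1
  mem_end : b ∈ W
  edge : ∀ y ∈ Icc (p x).2 (p b).2, ∃ u v, u ⋖ v ∧ (u = x ∨ u ∈ W) ∧ v ∈ W ∧
    (g y, y) ∈ segment ℝ (p u) (p v)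

namespace IsPlanarDiagram

theorem isTrace_lineAt (hp : IsPlanarDiagram p) {x a : L} (h : x ⋖ a) :
    IsTrace p x {a} a (lineAt (p x) (p a)) where
  continuous := continuous_lineAt _ _
  map_end := lineAt_right (hp.upward _ _ h.lt)
  mem_end := rfl
  edge _ hy := ⟨x, a, h, Or.inl rfl, rfl, lineAt_mem_segment (hp.upward _ _ h.lt) hy⟩

theorem exists_isTrace_insert (hp : IsPlanarDiagram p) {x b c : L} {W : Set L} {g : ℝ → ℝ}
    (hg : IsTrace p x W b g) (h : b ⋖ c) :
    ∃ g', IsTrace p x (insert c W) c g' ∧ ∀ y ≤ (p b).2, g' y = g y := by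
  have hlt := hp.upward _ _ h.lt
  refine ⟨fun y => if y ≤ (p b).2 then g y else lineAt (p b) (p c) y, ⟨?_, ?_, ?_, ?_⟩, ?_⟩
  · refine hg.continuous.if_le (continuous_lineAt _ _) continuous_id continuous_const ?_
    intro _ hy
    rw [show _ = (p b).2 from hy, hg.map_end, lineAt_left]
  · simp only [not_le.2 hlt, if_false]
    exact lineAt_right hlt
  · exact mem_insert _ _
  · intro y hy
    by_cases hyb : y ≤ (p b).2
    · obtain ⟨u, v, huv, hu, hv, hm⟩ := hg.edge y ⟨hy.1, hyb⟩
      simp only [hyb, if_true]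
      exact ⟨u, v, huv, hu.imp_right (mem_insert_of_mem _), mem_insert_of_mem _ hv, hm⟩
    · simp only [hyb, if_false]
      exact ⟨b, c, h, Or.inr (mem_insert_of_mem _ hg.mem_end), mem_insert _ _,
        lineAt_mem_segment hlt ⟨(not_le.1 hyb).le, hy.2⟩⟩
  · intro y hy
    simp only [hy, if_true]

/-- The two edges at a common point differ, since their upper ends lie in disjoint sets. So the
point is a vertex of both paths; the only vertex they can share is `x`, which is strictly lower. -/
theorem trace_ne_trace (hp : IsPlanarDiagram p) {x b b' : L} {W W' : Set L} {g g' : ℝ → ℝ}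
    (hg : IsTrace p x W b g) (hg' : IsTrace p x W' b' g') (hx : x ∉ W) (hx' : x ∉ W')
    (hW : Disjoint W W') {y : ℝ} (hy : (p x).2 < y) (hyb : y ≤ (p b).2) (hyb' : y ≤ (p b').2) :
    g y ≠ g' y := by
  intro heq
  obtain ⟨u, v, huv, hu, hv, hm⟩ := hg.edge y ⟨hy.le, hyb⟩
  obtain ⟨u', v', huv', hu', hv', hm'⟩ := hg'.edge y ⟨hy.le, hyb'⟩
  rw [← heq] at hm'
  have hne : (u, v) ≠ (u', v') := by
    rintro h
    obtain ⟨rfl, rfl⟩ := Prod.mk.inj h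
    exact disjoint_left.1 hW hv hv'
  obtain ⟨h, h'⟩ := hp.edge_edge u v u' v' huv huv' hne _ hm hm'
  have key : ∀ z z', (z = x ∨ z ∈ W) → (z' = x ∨ z' ∈ W') → (g y, y) = p z → (g y, y) = p z' →
      False := by
    intro z z' hz hz' h1 h2
    obtain rfl : z = z' := hp.injective (h1.symm.trans h2)
    have hzx : z ≠ x := by
      rintro rfl
      rw [← h1] at hy
      exact lt_irrefl _ hy
    exact disjoint_left.1 hW (hz.resolve_left hzx) (hz'.resolve_left hzx)
  rcases h with h | h <;> rcases h' with h' | h'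
  · exact key _ _ hu hu' h h'
  · exact key _ _ hu (Or.inr hv') h h'
  · exact key _ _ (Or.inr hv) hu' h h'
  · exact key _ _ (Or.inr hv) (Or.inr hv') h h'

/-- With equal slopes, the lower of the two upper ends would lie on the edge to the other. -/
theorem edgeSlope_ne (hp : IsPlanarDiagram p) {x a b : L} (ha : x ⋖ a) (hb : x ⋖ b)
    (hab : a ≠ b) : edgeSlope p x a ≠ edgeSlope p x b := by
  intro h
  have key : ∀ {a b : L}, x ⋖ a → x ⋖ b → edgeSlope p x a = edgeSlope p x b →
      (p a).2 ≤ (p b).2 → a = b := by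
    intro a b ha hb h hle
    have hm := lineAt_mem_segment (hp.upward _ _ hb.lt) ⟨(hp.upward _ _ ha.lt).le, hle⟩
    have : lineAt (p x) (p b) (p a).2 = (p a).1 := by
      have h1 := lineAt_right (hp.upward _ _ ha.lt)
      simp only [lineAt] at h1 ⊢
      simp only [edgeSlope] at h
      rw [← h, h1]
    rw [this] at hm
    exact (hp.vertex_edge x b a hb hm).resolve_left ha.lt.ne'
  rcases le_total (p a).2 (p b).2 with hle | hle
  · exact hab (key ha hb h hle)
  · exact hab (key hb ha h.symm hle).symm

/-- In a planar diagram, a path that starts between two paths meeting in `t` cannot lead to an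
element above `t` while avoiding them. -/
theorem not_edgeSlope_between (hp : IsPlanarDiagram p) {x a b c t u w : L}
    (ha : x ⋖ a) (hb : x ⋖ b) (hc : x ⋖ c) (hat : a ⋖ t) (hct : c ⋖ t) (hbu : b ⋖ u)
    (huw : u ⋖ w) (htw : t < w) (hbt : b ≠ t) (hut : u ≠ t) (hua : u ≠ a) (huc : u ≠ c)
    (hab : edgeSlope p x a < edgeSlope p x b) (hbc : edgeSlope p x b < edgeSlope p x c) :
    False := by
  have hxt : x < t := ha.lt.trans hat.lt
  have nab : b ≠ a := by rintro rfl; exact lt_irrefl _ hab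
  have nbc : b ≠ c := by rintro rfl; exact lt_irrefl _ hbc
  obtain ⟨l, hl, hl'⟩ := hp.exists_isTrace_insert (hp.isTrace_lineAt ha) hat
  obtain ⟨r, hr, hr'⟩ := hp.exists_isTrace_insert (hp.isTrace_lineAt hc) hct
  obtain ⟨m₁, hm₁, hm₁'⟩ := hp.exists_isTrace_insert (hp.isTrace_lineAt hb) hbu
  obtain ⟨m, hm, hm'⟩ := hp.exists_isTrace_insert hm₁ huw
  have hbu' := hp.upward _ _ hbu.lt
  -- At height `s` all three paths are still on their first edges, so the slopes determine their
  -- horizontal order.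
  obtain ⟨s, hxs, hsa, hsb, hsc⟩ : ∃ s, (p x).2 < s ∧ s ≤ (p a).2 ∧ s ≤ (p b).2 ∧ s ≤ (p c).2 :=
    ⟨min (p a).2 (min (p b).2 (p c).2), by
      simp [hp.upward _ _ ha.lt, hp.upward _ _ hb.lt, hp.upward _ _ hc.lt], by simp, by simp,
      by simp⟩
  have hst : s ≤ (p t).2 := hsa.trans (hp.upward _ _ hat.lt).le
  have htw' := hp.upward _ _ htw
  have hxW : x ∉ ({w, u, b} : Set L) := by
    simp [(hb.lt.trans (hbu.lt.trans huw.lt)).ne, (hb.lt.trans hbu.lt).ne, hb.lt.ne]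
  have ms : m s = lineAt (p x) (p b) s := by rw [hm' s (hsb.trans hbu'.le), hm₁' s hsb]
  -- The paths do not meet, so the order at `s` persists up to the height of `t`, where the outer
  -- paths coincide and leave no room for `m`.
  have hlm : l (p t).2 < m (p t).2 := by
    refine lt_of_forall_ne_of_lt hl.continuous hm.continuous hst ?_ ?_
    · rw [hl' s hsa, ms]
      exact lineAt_lt_lineAt hab hxs
    · intro y hy
      refine hp.trace_ne_trace hl hm ?_ hxW ?_ (hxs.trans_le hy.1) hy.2 (hy.2.trans htw'.le)
      · simp [hxt.ne, ha.lt.ne]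
      · simp [htw.ne', hut, hbt, (hat.lt.trans htw).ne', hua, nab]
  have hmr : m (p t).2 < r (p t).2 := by
    refine lt_of_forall_ne_of_lt hm.continuous hr.continuous hst ?_ ?_
    · rw [hr' s hsc, ms]
      exact lineAt_lt_lineAt hbc hxs
    · intro y hy
      refine (hp.trace_ne_trace hr hm ?_ hxW ?_ (hxs.trans_le hy.1) hy.2 (hy.2.trans htw'.le)).symm
      · simp [hxt.ne, hc.lt.ne]
      · simp [htw.ne', hut, hbt, (hct.lt.trans htw).ne', huc, nbc]
  rw [hl.map_end] at hlm
  rw [hr.map_end] at hmr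
  exact lt_asymm hlm hmr

end IsPlanarDiagram

end Geometry

/-! ### Upper covers in a planar distributive lattice -/

namespace IsPlanarDiagram

variable {L : Type u} [DistribLattice L] {p : L → ℝ × ℝ}

/-- By distributivity the three covers generate a Boolean cube. The outer covers enclose a region
closed off at `a ⊔ c`, and the path from `x` through `b` and `b ⊔ a` to the top of the cube would
have to escape it. -/
theorem not_edgeSlope_lt_lt (hp : IsPlanarDiagram p) {x a b c : L}
    (ha : x ⋖ a) (hb : x ⋖ b) (hc : x ⋖ c)
    (hab : edgeSlope p x a < edgeSlope p x b) (hbc : edgeSlope p x b < edgeSlope p x c) :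
    False := by
  have inf_eq : ∀ {a b : L}, x ⋖ a → x ⋖ b → a ≠ b → a ⊓ b = x := by
    intro a b ha hb h
    by_contra hne
    have hlt : x < a ⊓ b := lt_of_le_of_ne (le_inf ha.le hb.le) (Ne.symm hne)
    have h1 : a ⊓ b = a := (ha.eq_or_eq hlt.le inf_le_left).resolve_left hne
    have h2 : a ⊓ b = b := (hb.eq_or_eq hlt.le inf_le_right).resolve_left hne
    exact h (h1.symm.trans h2)
  have nab : a ≠ b := by rintro rfl; exact lt_irrefl _ hab
  have nbc : b ≠ c := by rintro rfl; exact lt_irrefl _ hbc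
  have nac : a ≠ c := by rintro rfl; exact lt_asymm hab hbc
  have iab := inf_eq ha hb nab
  have iac := inf_eq ha hc nac
  have ibc := inf_eq hb hc nbc
  have nle : ∀ {a b : L}, x ⋖ a → a ⊓ b = x → ¬ a ≤ b := by
    intro a b ha h hle
    rw [inf_eq_left.2 hle] at h
    exact ha.lt.ne h.symm
  have hsup : ∀ {a b : L}, x ⋖ b → a ⊓ b = x → a ⋖ a ⊔ b := by
    intro a b hb h
    rw [sup_comm]
    apply IsUpperModularLattice.covBy_sup_of_inf_covBy
    rwa [inf_comm, h]
  have iabc : (b ⊔ a) ⊓ c = x := by rw [inf_sup_right, ibc, iac, sup_idem]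
  have ibac : b ⊓ (a ⊔ c) = x := by rw [inf_sup_left, inf_comm b a, iab, ibc, sup_idem]
  have nbt := nle hb ibac
  refine hp.not_edgeSlope_between (t := a ⊔ c) (u := b ⊔ a) (w := b ⊔ a ⊔ c) ha hb hc
    (hsup hc iac) ?_ (hsup ha (by rwa [inf_comm])) (hsup hc iabc) ?_ ?_ ?_ ?_ ?_ hab hbc
  · rw [sup_comm]
    exact hsup ha (by rwa [inf_comm])
  · refine lt_of_le_of_ne (sup_le_sup_right le_sup_right _) ?_
    intro h
    exact nbt (h ▸ le_sup_left.trans le_sup_left)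
  · exact fun h => nbt h.le
  · exact fun h => nbt (h ▸ le_sup_left)
  · exact fun h => nle hb (by rwa [inf_comm]) (le_sup_left.trans h.le : b ≤ a)
  · exact fun h => nle hb ibc (le_sup_left.trans h.le)

/-- In a planar distributive lattice, no element has three upper covers. -/
theorem not_three_covBy (hp : IsPlanarDiagram p) {x a b c : L}
    (ha : x ⋖ a) (hb : x ⋖ b) (hc : x ⋖ c) (hab : a ≠ b) (hac : a ≠ c) (hbc : b ≠ c) : False := by
  have h1 := hp.edgeSlope_ne ha hb hab
  have h2 := hp.edgeSlope_ne ha hc hac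
  have h3 := hp.edgeSlope_ne hb hc hbc
  rcases h1.lt_or_gt with h1 | h1 <;> rcases h2.lt_or_gt with h2 | h2 <;>
    rcases h3.lt_or_gt with h3 | h3
  · exact hp.not_edgeSlope_lt_lt ha hb hc h1 h3
  · exact hp.not_edgeSlope_lt_lt ha hc hb h2 h3
  · linarith
  · exact hp.not_edgeSlope_lt_lt hc ha hb h2 h1
  · exact hp.not_edgeSlope_lt_lt hb ha hc h1 h2
  · linarith
  · exact hp.not_edgeSlope_lt_lt hb hc ha h3 h2
  · exact hp.not_edgeSlope_lt_lt hc hb ha h3 h1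

end IsPlanarDiagram

/-! ### Join-prime elements and width at most two -/

theorem exists_supPrime_le_not_le {B : Type u} [DistribLattice B] [Finite B] {a b : B}
    (h : ¬ a ≤ b) : ∃ j, SupPrime j ∧ j ≤ a ∧ ¬ j ≤ b := by
  obtain ⟨j, hj⟩ := (Set.toFinite {j : B | j ≤ a ∧ ¬ j ≤ b}).exists_minimal ⟨a, le_rfl, h⟩
  refine ⟨j, supPrime_iff_supIrred.2 ⟨?_, ?_⟩, hj.prop.1, hj.prop.2⟩
  · intro hmin
    exact hj.prop.2 ((hmin inf_le_left).trans inf_le_right)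
  · intro c d hcd
    have key : ∀ e, e ≤ j → ¬ e ≤ b → e = j := fun e he heb =>
      le_antisymm he (hj.le_of_le ⟨he.trans hj.prop.1, heb⟩ he)
    by_cases hc : c ≤ b
    · refine Or.inr (key d (hcd ▸ le_sup_right) fun hd => hj.prop.2 ?_)
      rw [← hcd]
      exact sup_le hc hd
    · exact Or.inl (key c (hcd ▸ le_sup_left) hc)

theorem IsPlanarLattice.not_supPrime_antichain {B : Type u} [DistribLattice B]
    (hB : IsPlanarLattice B) {i j k : B} (hi : SupPrime i) (hj : SupPrime j) (hk : SupPrime k)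
    (hij : ¬ i ≤ j) (hji : ¬ j ≤ i) (hik : ¬ i ≤ k) (hki : ¬ k ≤ i) (hjk : ¬ j ≤ k)
    (hkj : ¬ k ≤ j) : False := by
  classical
  obtain ⟨hfin, -, p, hp⟩ := hB
  have := Fintype.ofFinite B
  -- The join `x` of everything strictly below `i`, `j` or `k` lies above none of the three, by
  -- join-primeness; hence `x ⊔ i`, `x ⊔ j`, `x ⊔ k` are three distinct upper covers of `x`.
  let S : Finset B := Finset.univ.filter fun y => y < i ∨ y < j ∨ y < k
  have hS : S.Nonempty := ⟨i ⊓ j, by simp [S, hij]⟩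
  let x := S.sup' hS id
  have hmem : ∀ y, y < i ∨ y < j ∨ y < k → y ≤ x := fun y hy =>
    Finset.le_sup' id (by simpa [S] using hy)
  have hle : ∀ l, SupPrime l → l ≤ x → ∃ y, (y < i ∨ y < j ∨ y < k) ∧ l ≤ y := by
    intro l hl hlx
    have : ∀ (T : Finset B) (hT : T.Nonempty), l ≤ T.sup' hT id → ∃ y ∈ T, l ≤ y := by
      intro T hT
      induction hT using Finset.Nonempty.cons_induction with
      | singleton a => simp
      | cons a s ha hs ih =>
        intro h
        rw [Finset.sup'_cons hs, hl.le_sup] at h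
        rcases h with h | h
        · exact ⟨a, by simp, h⟩
        · obtain ⟨y, hy, h⟩ := ih h
          exact ⟨y, by simp [hy], h⟩
    obtain ⟨y, hy, h⟩ := this S hS hlx
    exact ⟨y, by simpa [S] using hy, h⟩
  have hcov : ∀ l, ¬ l ≤ x → (∀ y < l, y ≤ x) → x ⋖ x ⊔ l := by
    intro l hl hlt
    refine ⟨lt_of_le_of_ne le_sup_left fun h => hl (h ▸ le_sup_right), ?_⟩
    intro z hxz hzl
    have hz : z = x ⊔ z ⊓ l := by
      conv_lhs => rw [← inf_eq_left.2 hzl.le, inf_sup_left, inf_eq_right.2 hxz.le]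
    rcases (inf_le_right : z ⊓ l ≤ l).eq_or_lt with h | h
    · rw [h] at hz
      exact hzl.ne hz
    · rw [sup_eq_left.2 (hlt _ h)] at hz
      exact hxz.ne' hz
  have hne : ∀ l m, SupPrime l → ¬ l ≤ x → ¬ l ≤ m → x ⊔ l ≠ x ⊔ m := by
    intro l m hl hlx hlm h
    have : l ≤ x ⊔ m := h ▸ le_sup_right
    exact (hl.le_sup.1 this).elim hlx hlm
  have hix : ¬ i ≤ x := by
    intro h
    obtain ⟨y, hy | hy | hy, h⟩ := hle i hi h
    · exact lt_irrefl _ (h.trans_lt hy)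
    · exact hij (h.trans hy.le)
    · exact hik (h.trans hy.le)
  have hjx : ¬ j ≤ x := by
    intro h
    obtain ⟨y, hy | hy | hy, h⟩ := hle j hj h
    · exact hji (h.trans hy.le)
    · exact lt_irrefl _ (h.trans_lt hy)
    · exact hjk (h.trans hy.le)
  have hkx : ¬ k ≤ x := by
    intro h
    obtain ⟨y, hy | hy | hy, h⟩ := hle k hk h
    · exact hki (h.trans hy.le)
    · exact hkj (h.trans hy.le)
    · exact lt_irrefl _ (h.trans_lt hy)
  exact hp.not_three_covBy (hcov i hix fun y hy => hmem y (by simp [hy]))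
    (hcov j hjx fun y hy => hmem y (by simp [hy])) (hcov k hkx fun y hy => hmem y (by simp [hy]))
    (hne i j hi hix hij) (hne i k hi hix hik) (hne j k hj hjx hjk)

/-- Dilworth's theorem for width at most two. -/
theorem exists_isChain_isChain_sdiff {α : Type u} [PartialOrder α] (s : Finset α)
    (hs : ∀ x ∈ s, ∀ y ∈ s, ∀ z ∈ s, ¬ x ≤ y → ¬ y ≤ x → ¬ x ≤ z → ¬ z ≤ x → ¬ y ≤ z → ¬ z ≤ y →
      False) :
    ∃ C ⊆ s, IsChain (· ≤ ·) (C : Set α) ∧ IsChain (· ≤ ·) ((s : Set α) \ C) := by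
  classical
  induction s using Finset.strongInduction with
  | H s ih =>
  rcases s.eq_empty_or_nonempty with rfl | hne
  · exact ⟨∅, by simp⟩
  obtain ⟨a, ha⟩ := s.exists_maximal hne
  have hamax : ∀ z ∈ s, a ≤ z → z = a := fun z hz h => le_antisymm (ha.le_of_ge hz h) h
  obtain ⟨C, hCs, hC, hC'⟩ := ih (s.erase a) (Finset.erase_ssubset ha.prop)
    fun x hx y hy z hz => hs x (Finset.mem_of_mem_erase hx) y (Finset.mem_of_mem_erase hy) z
      (Finset.mem_of_mem_erase hz)
  let C' := s.erase a \ C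
  have hC' : IsChain (· ≤ ·) (C' : Set α) := by simpa [C'] using hC'
  have hC's : C' ⊆ s.erase a := Finset.sdiff_subset
  have hmem : ∀ z ∈ s, z ≠ a → z ∈ C ∨ z ∈ C' := by
    intro z hz hza
    by_cases h : z ∈ C
    · exact Or.inl h
    · exact Or.inr (by simp [C', h, hz, hza])
  -- Move `a` on top of the part of `C` up to `x`; the rest of `C` is comparable with all of `C'`,
  -- so together they form the second chain.
  have main : ∀ C C' : Finset α, C ⊆ s.erase a → C' ⊆ s.erase a →
      IsChain (· ≤ ·) (C : Set α) → IsChain (· ≤ ·) (C' : Set α) →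
      (∀ z ∈ s, z ≠ a → z ∈ C ∨ z ∈ C') →
      ∀ x ∈ C, x ≤ a → (∀ u ∈ C, x < u → ∀ v ∈ C', u ≤ v ∨ v ≤ u) →
      ∃ C ⊆ s, IsChain (· ≤ ·) (C : Set α) ∧ IsChain (· ≤ ·) ((s : Set α) \ C) := by
    intro C C' hCs hC's hC hC' hmem x hx hxa hcmp
    refine ⟨insert a (C.filter (· ≤ x)), ?_, ?_, ?_⟩
    · intro z hz
      rcases Finset.mem_insert.1 hz with rfl | hz
      · exact ha.prop
      · exact Finset.mem_of_mem_erase (hCs (Finset.mem_filter.1 hz).1)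
    · rw [Finset.coe_insert]
      refine (hC.mono fun z hz => (Finset.mem_filter.1 hz).1).insert fun z hz _ => Or.inr ?_
      exact (Finset.mem_filter.1 hz).2.trans hxa
    · have hmem' : ∀ z ∈ (s : Set α) \ (insert a (C.filter (· ≤ x)) : Finset α),
          (z ∈ C ∧ x < z) ∨ z ∈ C' := by
        rintro z ⟨hz, hz'⟩
        simp only [Finset.coe_insert, Set.mem_insert_iff, Finset.mem_coe, Finset.mem_filter,
          not_or, not_and] at hz'
        rcases hmem z hz hz'.1 with h | h
        · refine Or.inl ⟨h, ?_⟩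
          rcases hC.total hx h with h' | h'
          · exact lt_of_le_of_ne h' (by rintro rfl; exact hz'.2 h le_rfl)
          · exact absurd h' (hz'.2 h)
        · exact Or.inr h
      intro y hy z hz hyz
      rcases hmem' y hy with ⟨h1, h2⟩ | h1 <;> rcases hmem' z hz with ⟨h3, h4⟩ | h3
      · exact hC h1 h3 hyz
      · exact hcmp y h1 h2 z h3
      · exact (hcmp z h3 h4 y h1).symm
      · exact hC' h1 h3 hyz
  by_cases hanti : ∃ u ∈ C, ∃ v ∈ C', ¬ u ≤ v ∧ ¬ v ≤ u
  · obtain ⟨u, hu, v, hv, huv, hvu⟩ := hanti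
    -- The last element of each chain that is incomparable to something in the other. These two turn
    -- out incomparable to each other, so the maximal element `a` must lie above one of them.
    have exmax : ∀ (C C' : Finset α), (∃ u ∈ C, ∃ v ∈ C', ¬ u ≤ v ∧ ¬ v ≤ u) →
        ∃ x ∈ C, (∃ v ∈ C', ¬ x ≤ v ∧ ¬ v ≤ x) ∧
          ∀ u ∈ C, x < u → ∀ v ∈ C', u ≤ v ∨ v ≤ u := by
      intro C C' ⟨u, hu, v, hv, h⟩
      obtain ⟨x, hx⟩ := (C.filter fun u => ∃ v ∈ C', ¬ u ≤ v ∧ ¬ v ≤ u).exists_maximal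
        ⟨u, Finset.mem_filter.2 ⟨hu, v, hv, h⟩⟩
      have hx' := Finset.mem_filter.1 hx.prop
      refine ⟨x, hx'.1, hx'.2, fun u hu hxu v hv => ?_⟩
      by_contra! hcon
      exact hx.not_gt (Finset.mem_filter.2 ⟨hu, v, hv, hcon⟩) hxu
    obtain ⟨x, hx, ⟨y', hy', hxy'⟩, hxmax⟩ := exmax C C' ⟨u, hu, v, hv, huv, hvu⟩
    obtain ⟨y, hy, ⟨x', hx', hyx'⟩, hymax⟩ := exmax C' C ⟨v, hv, u, hu, hvu, huv⟩
    have hx'x : x' ≤ x := by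
      rcases hC.total hx hx' with h | h
      · rcases h.eq_or_lt with rfl | h
        · exact le_rfl
        · exact absurd (hxmax x' hx' h y hy) (by tauto)
      · exact h
    have hy'y : y' ≤ y := by
      rcases hC'.total hy hy' with h | h
      · rcases h.eq_or_lt with rfl | h
        · exact le_rfl
        · exact absurd (hymax y' hy' h x hx) (by tauto)
      · exact h
    have hxy : ¬ x ≤ y := fun h => hyx'.2 (hx'x.trans h)
    have hyx : ¬ y ≤ x := fun h => hxy'.2 (hy'y.trans h)
    have hxs := Finset.mem_erase.1 (hCs hx)
    have hys := Finset.mem_erase.1 (hC's hy)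
    by_cases hxa : x ≤ a
    · exact main C C' hCs hC's hC hC' hmem x hx hxa hxmax
    by_cases hya : y ≤ a
    · exact main C' C hC's hCs hC' hC (fun z hz hza => (hmem z hz hza).symm) y hy hya hymax
    exact (hs x hxs.2 y hys.2 a ha.prop hxy hyx hxa (fun h => hxs.1 (hamax x hxs.2 h)) hya
      (fun h => hys.1 (hamax y hys.2 h))).elim
  · push Not at hanti
    refine ⟨{a}, by simpa using ha.prop, by simp, ?_⟩
    intro y hy z hz hyz
    have hy' := hmem y hy.1 (by simpa using hy.2)
    have hz' := hmem z hz.1 (by simpa using hz.2)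
    have tot : ∀ u ∈ C, ∀ v ∈ C', u ≤ v ∨ v ≤ u := fun u hu v hv =>
      or_iff_not_imp_left.2 (hanti u hu v hv)
    rcases hy' with h | h <;> rcases hz' with h' | h'
    · exact hC h h' hyz
    · exact tot y h z h'
    · exact (tot z h' y h).symm
    · exact hC' h h' hyz

/-! ### Planarity of a product of two finite chains -/

section ChainProduct

theorem ncard_Iio_strictMono (C : Type u) [LinearOrder C] [Finite C] :
    StrictMono fun c : C => (Iio c).ncard := fun _ _ h =>
  ncard_lt_ncard (Iio_ssubset_Iio h) (toFinite _)

theorem ncard_Iio_of_covBy {C : Type u} [LinearOrder C] [Finite C] {c d : C} (h : c ⋖ d) :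
    (Iio d).ncard = (Iio c).ncard + 1 := by
  have : Iio d = insert c (Iio c) := by
    rw [Iio_insert]
    exact h.Iio_eq
  rw [this, ncard_insert_of_notMem (by simp) (toFinite _)]

/-- The diagram draws the grid turned by 45 degrees; sum and difference of the plane coordinates
recover twice the grid coordinates. -/
theorem mem_segment_diag {m n m' n' : ℕ} {q : ℝ × ℝ}
    (hq : q ∈ segment ℝ ((m : ℝ) - n, (m : ℝ) + n) ((m' : ℝ) - n', (m' : ℝ) + n')) :
    ∃ s ∈ Icc (0 : ℝ) 1, q.1 + q.2 = 2 * (m + s * (m' - m)) ∧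
      q.2 - q.1 = 2 * (n + s * (n' - n)) := by
  rw [segment_eq_image'] at hq
  obtain ⟨s, hs, rfl⟩ := hq
  refine ⟨s, hs, ?_, ?_⟩ <;> simp <;> ring

/-- Two edges of the grid `ℕ × ℕ` meet at most in common endpoints. -/
theorem grid_edge_edge {m n m' n' k l k' l' : ℕ} {s t : ℝ} (hs : s ∈ Icc (0 : ℝ) 1)
    (ht : t ∈ Icc (0 : ℝ) 1)
    (h : m' = m + 1 ∧ n' = n ∨ m' = m ∧ n' = n + 1)
    (h' : k' = k + 1 ∧ l' = l ∨ k' = k ∧ l' = l + 1)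
    (hne : ¬ (m = k ∧ n = l ∧ m' = k' ∧ n' = l'))
    (h1 : (m : ℝ) + s * (m' - m) = k + t * (k' - k))
    (h2 : (n : ℝ) + s * (n' - n) = l + t * (l' - l)) : s = 0 ∨ s = 1 := by
  obtain ⟨hs0, hs1⟩ := hs
  obtain ⟨ht0, ht1⟩ := ht
  by_contra! hcon
  have hs0 := lt_of_le_of_ne hs0 hcon.1.symm
  have hs1 := lt_of_le_of_ne hs1 hcon.2
  have nat_eq : ∀ {a b : ℕ} {s t : ℝ}, 0 < s → s < 1 → 0 ≤ t → t ≤ 1 → (a : ℝ) + s = b + t →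
      a = b := by
    intro a b s t hs0 hs1 ht0 ht1 h
    have h1 : (a : ℝ) < b + 1 := by linarith
    have h2 : (b : ℝ) < a + 1 := by linarith
    norm_cast at h1 h2
    omega
  have not_nat : ∀ {a b : ℕ} {s : ℝ}, 0 < s → s < 1 → (a : ℝ) + s = b → False := by
    intro a b s hs0 hs1 h
    have h1 : (a : ℝ) < b := by linarith
    have h2 : (b : ℝ) < a + 1 := by linarith
    norm_cast at h1 h2
    omega
  rcases h with ⟨rfl, rfl⟩ | ⟨rfl, rfl⟩ <;> rcases h' with ⟨rfl, rfl⟩ | ⟨rfl, rfl⟩ <;>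
    push_cast at h1 h2 <;> ring_nf at h1 h2
  · have h2 : n' = l' := by exact_mod_cast h2
    have h1 := nat_eq hs0 hs1 ht0 ht1 h1
    omega
  · exact not_nat hs0 hs1 h1
  · exact not_nat hs0 hs1 (by linarith : (n : ℝ) + s = l')
  · have h1 : m' = k' := by exact_mod_cast h1
    have h2 := nat_eq hs0 hs1 ht0 ht1 (by linarith : (n : ℝ) + s = l + t)
    omega

theorem isPlanarLattice_prod (C₁ C₂ : Type u) [LinearOrder C₁] [LinearOrder C₂] [Finite C₁]
    [Finite C₂] [Nonempty C₁] [Nonempty C₂] : IsPlanarLattice (C₁ × C₂) := by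
  let r₁ : C₁ → ℕ := fun c => (Iio c).ncard
  let r₂ : C₂ → ℕ := fun c => (Iio c).ncard
  have m₁ : StrictMono r₁ := ncard_Iio_strictMono C₁
  have m₂ : StrictMono r₂ := ncard_Iio_strictMono C₂
  let p : C₁ × C₂ → ℝ × ℝ := fun x => ((r₁ x.1 : ℝ) - r₂ x.2, (r₁ x.1 : ℝ) + r₂ x.2)
  have hcov : ∀ {x y : C₁ × C₂}, x ⋖ y → r₁ y.1 = r₁ x.1 + 1 ∧ r₂ y.2 = r₂ x.2 ∨
      r₁ y.1 = r₁ x.1 ∧ r₂ y.2 = r₂ x.2 + 1 := by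
    intro x y h
    rcases Prod.mk_covBy_mk_iff.1 h with ⟨h1, h2⟩ | ⟨h1, h2⟩
    · exact Or.inl ⟨ncard_Iio_of_covBy h1, by rw [h2]⟩
    · exact Or.inr ⟨by rw [h2], ncard_Iio_of_covBy h1⟩
  have hinj : ∀ {x y : C₁ × C₂}, r₁ x.1 = r₁ y.1 → r₂ x.2 = r₂ y.2 → x = y := fun h1 h2 =>
    Prod.ext (m₁.injective h1) (m₂.injective h2)
  have hend : ∀ {x y : C₁ × C₂} {q : ℝ × ℝ} {s : ℝ},
      q.1 + q.2 = 2 * (r₁ x.1 + s * (r₁ y.1 - r₁ x.1)) →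
      q.2 - q.1 = 2 * (r₂ x.2 + s * (r₂ y.2 - r₂ x.2)) → s = 0 ∨ s = 1 → q = p x ∨ q = p y := by
    rintro x y q s h1 h2 (rfl | rfl)
    · exact Or.inl (Prod.ext (by simp only [p]; linarith) (by simp only [p]; linarith))
    · exact Or.inr (Prod.ext (by simp only [p]; linarith) (by simp only [p]; linarith))
  have hpinj : Function.Injective p := by
    intro x y h
    obtain ⟨h1, h2⟩ := Prod.mk.inj h
    refine hinj ?_ ?_
    · have : (r₁ x.1 : ℝ) = r₁ y.1 := by linarith
      exact_mod_cast this
    · have : (r₂ x.2 : ℝ) = r₂ y.2 := by linarith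
      exact_mod_cast this
  refine ⟨inferInstance, inferInstance, p, hpinj, ?_, ?_, ?_⟩
  · intro x y h
    have : r₁ x.1 + r₂ x.2 < r₁ y.1 + r₂ y.2 := by
      rcases Prod.lt_iff.1 h with ⟨h1, h2⟩ | ⟨h1, h2⟩
      · exact add_lt_add_of_lt_of_le (m₁ h1) (m₂.monotone h2)
      · exact add_lt_add_of_le_of_lt (m₁.monotone h1) (m₂ h2)
    simp only [p]
    exact_mod_cast this
  · intro x y z h hz
    obtain ⟨s, hs, h1, h2⟩ := mem_segment_diag hz
    have key : s = 0 ∨ s = 1 := by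
      have e1 : (r₁ z.1 : ℝ) = r₁ x.1 + s * (r₁ y.1 - r₁ x.1) := by
        simp only [p] at h1; linarith
      have e2 : (r₂ z.2 : ℝ) = r₂ x.2 + s * (r₂ y.2 - r₂ x.2) := by
        simp only [p] at h2; linarith
      -- The vertex `z` is treated as the end `t = 0` of an auxiliary edge of `ℕ × ℕ`; the case
      -- where that edge is the given one is separate and gives `s = 0`.
      by_cases hxz : r₁ x.1 = r₁ z.1 ∧ r₂ x.2 = r₂ z.2 ∧ r₁ y.1 = r₁ z.1 + 1 ∧ r₂ y.2 = r₂ z.2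
      · refine Or.inl ?_
        rw [hxz.1, hxz.2.2.1] at e1
        push_cast at e1
        linarith
      · exact grid_edge_edge (k' := r₁ z.1 + 1) (l' := r₂ z.2) (t := 0) hs (by simp) (hcov h)
          (Or.inl ⟨rfl, rfl⟩) hxz (by rw [← e1]; simp) (by rw [← e2]; simp)
    exact (hend h1 h2 key).imp (fun h => hpinj h) fun h => hpinj h
  · intro x y x' y' h h' hne q hq hq'
    obtain ⟨s, hs, h1, h2⟩ := mem_segment_diag hq
    obtain ⟨t, ht, h1', h2'⟩ := mem_segment_diag hq'
    have hne' : ¬ (r₁ x.1 = r₁ x'.1 ∧ r₂ x.2 = r₂ x'.2 ∧ r₁ y.1 = r₁ y'.1 ∧ r₂ y.2 = r₂ y'.2) := by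
      rintro ⟨a, b, c, d⟩
      exact hne (Prod.ext (hinj a b) (hinj c d))
    constructor
    · exact hend h1 h2 (grid_edge_edge hs ht (hcov h) (hcov h') hne' (by linarith) (by linarith))
    · refine hend h1' h2' (grid_edge_edge ht hs (hcov h') (hcov h) ?_ (by linarith) (by linarith))
      rintro ⟨a, b, c, d⟩
      exact hne' ⟨a.symm, b.symm, c.symm, d.symm⟩

end ChainProduct

/-! ### Rigidity of cover-preserving extensions -/

/-- A retraction of a cover-preserving {0,1}-extension of finite distributive lattices is
injective. -/
theorem IsCoverPreservingZeroOneHom.injective_of_leftInverse {A B : Type u} [DistribLattice A]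
    [DistribLattice B] [Finite A] [Finite B] {ι : LatticeHom A B}
    (hι : IsCoverPreservingZeroOneHom ι) {f : LatticeHom B A} (hf : ∀ a, f (ι a) = a) :
    Function.Injective f := by
  intro x y hxy
  by_contra hne
  have hlt : ¬ x ⊔ y ≤ x ⊓ y := fun h =>
    hne (le_antisymm (le_sup_left.trans (h.trans inf_le_right))
      (le_sup_right.trans (h.trans inf_le_left)))
  have heq : f (x ⊔ y) = f (x ⊓ y) := by simp [hxy]
  obtain ⟨j, hj, hjy, hjx⟩ := exists_supPrime_le_not_le hlt
  -- A failure of injectivity is pushed down to a join-prime: `f` identifies `j` with the strictly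
  -- smaller `z`.
  set z := (x ⊓ y) ⊓ j with hz
  have hfz : f z = f j := by rw [hz, map_inf, ← heq, ← map_inf, inf_eq_right.2 hjy]
  have hjz : ¬ j ≤ z := fun h => hjx (h.trans inf_le_left)
  have : Nonempty A := ⟨f j⟩
  obtain ⟨t, ht⟩ := (Set.toFinite (Set.univ : Set A)).exists_maximal univ_nonempty
  have htop : IsTop t := fun a => by
    have := ht.le_of_ge (mem_univ (t ⊔ a)) le_sup_left
    exact le_sup_right.trans this
  -- Take a lower cover `d` of this `e`. As `ι d ⋖ ι e`, joining `j` to `ι d` gives `ι e`, while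
  -- joining `z` gives `ι d`; since `f z = f j`, the retraction identifies `d` with `e`.
  obtain ⟨e, he⟩ := (Set.toFinite {a : A | j ≤ ι a}).exists_minimal ⟨t, hι.map_one t htop j⟩
  have hje : j ≤ ι e := he.prop
  have hemin : ¬ IsMin e := by
    intro h
    have hb : IsBot e := fun a => (h inf_le_left).trans inf_le_right
    exact hj.not_isMin fun b _ => hje.trans (hι.map_zero e hb b)
  obtain ⟨d', hd'⟩ := not_isMin_iff.1 hemin
  obtain ⟨d, -, hde⟩ := exists_le_covBy_of_lt hd'
  have hjd : ¬ j ≤ ι d := fun h => he.not_lt h hde.lt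
  have hcov := hι.map_covBy d e hde
  have h1 : ι d ⊔ j = ι e :=
    (hcov.eq_or_eq le_sup_left (sup_le hcov.le hje)).resolve_left
      fun h => hjd (h ▸ le_sup_right)
  have h2 : ι d ⊔ z = ι d :=
    (hcov.eq_or_eq le_sup_left (sup_le hcov.le (inf_le_right.trans hje))).resolve_right
      fun h => (hj.le_sup.1 (hje.trans h.ge)).elim hjd hjz
  have h3 : f (ι e) = f (ι d) := by rw [← h1, map_sup, ← hfz, ← map_sup, h2]
  rw [hf, hf] at h3
  exact hde.lt.ne' h3

theorem IsCoverPreservingZeroOneHom.of_orderIso {A B : Type u} [Lattice A] [Lattice B]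
    (f : LatticeHom A B) (e : A ≃o B) (h : ∀ a, f a = e a) : IsCoverPreservingZeroOneHom f where
  map_zero a ha b := by
    rw [h, ← e.le_symm_apply]
    exact ha _
  map_one a ha b := by
    rw [h, ← e.symm_apply_le]
    exact ha _
  map_covBy a b hab := by
    rw [h, h]
    exact (apply_covBy_apply_iff e).2 hab

/-- The retraction in `injective_of_leftInverse` is an isomorphism. -/
noncomputable def LatticeHom.orderIsoOfLeftInverse {A B : Type u} [Lattice A] [Lattice B]
    (ι : LatticeHom A B) (f : LatticeHom B A) (hf : ∀ a, f (ι a) = a)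
    (hinj : Function.Injective f) : B ≃o A where
  toFun := f
  invFun := ι
  left_inv b := hinj (hf (f b))
  right_inv := hf
  map_rel_iff' {a b} := by
    constructor
    · intro h
      have := OrderHomClass.mono ι h
      have key : ∀ b, ι (f b) = b := fun b => hinj (hf (f b))
      simpa [key] using this
    · exact fun h => OrderHomClass.mono f h

/-! ### Retractions onto chain products and two-element lattices -/

/-- A lattice homomorphism onto a finite chain from an increasing family of join-prime elements. -/
theorem exists_latticeHom_of_supPrime {B C : Type u} [DistribLattice B] [LinearOrder C] [OrderBot C]
    [Finite C] (j : C → B) (hj : ∀ c ≠ ⊥, SupPrime (j c))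
    (hmono : ∀ c ≠ ⊥, ∀ d ≠ ⊥, c ≤ d → j c ≤ j d) :
    ∃ g : LatticeHom B C, ∀ x, ∀ c ≠ ⊥, c ≤ g x ↔ j c ≤ x := by
  classical
  have := Fintype.ofFinite C
  let g : B → C := fun x => (Finset.univ.filter fun c => c ≠ ⊥ ∧ j c ≤ x).sup id
  have hg : ∀ x, ∀ c ≠ ⊥, c ≤ g x ↔ j c ≤ x := by
    intro x c hc
    constructor
    · intro h
      obtain ⟨d, hd, hcd⟩ := (Finset.le_sup_iff (bot_lt_iff_ne_bot.2 hc)).1 h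
      obtain ⟨-, hd, hdx⟩ := Finset.mem_filter.1 hd
      exact (hmono c hc d hd hcd).trans hdx
    · exact fun h => Finset.le_sup (f := id) (by simp [hc, h])
  have ext : ∀ a b : C, (∀ c ≠ ⊥, c ≤ a ↔ c ≤ b) → a = b := by
    intro a b h
    refine le_antisymm ?_ ?_
    · by_cases ha : a = ⊥
      · exact ha ▸ bot_le
      · exact (h a ha).1 le_rfl
    · by_cases hb : b = ⊥
      · exact hb ▸ bot_le
      · exact (h b hb).2 le_rfl
  refine ⟨⟨⟨g, fun x y => ext _ _ fun c hc => ?_⟩, fun x y => ext _ _ fun c hc => ?_⟩, hg⟩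
  · rw [hg _ c hc, (hj c hc).le_sup, le_sup_iff, hg _ c hc, hg _ c hc]
  · show c ≤ g (x ⊓ y) ↔ c ≤ g x ⊓ g y
    rw [hg _ c hc, le_inf_iff, le_inf_iff, hg _ c hc, hg _ c hc]

/-- A retraction onto the first of two chains whose product is contained in a planar distributive
lattice. -/
theorem IsPlanarLattice.exists_latticeHom_fst {B C₁ C₂ : Type u} [DistribLattice B]
    (hB : IsPlanarLattice B) [LinearOrder C₁] [LinearOrder C₂] [Finite C₁] [BoundedOrder C₁]
    [BoundedOrder C₂] [Nontrivial C₂] (ι : C₁ × C₂ → B) (hmono : Monotone ι)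
    (hι : ∀ {x y}, ι x ≤ ι y → x ≤ y) : ∃ g : LatticeHom B C₁, ∀ x, g (ι x) = x.1 := by
  have := hB.finite
  -- It suffices to separate `ι (c, ⊥)` from `ι (b, ⊤)` for the lower cover `b` of `c`. The value at
  -- `⊥` is a dummy.
  have hex : ∀ c : C₁, ∃ j, c ≠ ⊥ → SupPrime j ∧ j ≤ ι (c, ⊥) ∧ ∀ d < c, ¬ j ≤ ι (d, ⊤) := by
    intro c
    by_cases hc : c = ⊥
    · exact ⟨ι (c, ⊥), fun h => absurd hc h⟩
    · obtain ⟨b, -, hb⟩ := exists_le_covBy_of_lt (bot_lt_iff_ne_bot.2 hc)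
      obtain ⟨j, h1, h2, h3⟩ := exists_supPrime_le_not_le (a := ι (c, ⊥)) (b := ι (b, ⊤))
        fun h => hb.lt.not_ge (hι h).1
      exact ⟨j, fun _ => ⟨h1, h2, fun d hd h => h3 (h.trans
        (hmono ⟨hb.le_of_lt hd, le_rfl⟩))⟩⟩
  choose j hj using hex
  -- This `k` is incomparable to every `j c` with `c ≠ ⊥`, so two incomparable such `j c` would
  -- complete a 3-antichain. Here nontriviality of `C₂` is essential.
  obtain ⟨k, hk, hk1, hk2⟩ := exists_supPrime_le_not_le (a := ι (⊥, ⊤)) (b := ι (⊤, ⊥))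
    fun h => bot_lt_top.not_ge (hι h).2
  have hkj : ∀ c ≠ ⊥, ¬ k ≤ j c := fun c hc h =>
    hk2 (h.trans ((hj c hc).2.1.trans (hmono ⟨le_top, le_rfl⟩)))
  have hjk : ∀ c ≠ ⊥, ¬ j c ≤ k := fun c hc h =>
    (hj c hc).2.2 ⊥ (bot_lt_iff_ne_bot.2 hc) (h.trans hk1)
  obtain ⟨g, hg⟩ := exists_latticeHom_of_supPrime j (fun c hc => (hj c hc).1) (by
    intro c hc d hd hcd
    rcases hcd.eq_or_lt with rfl | hlt
    · exact le_rfl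
    by_contra hcon
    refine hB.not_supPrime_antichain (hj c hc).1 (hj d hd).1 hk hcon ?_ (hjk c hc) (hkj c hc)
      (hjk d hd) (hkj d hd)
    exact fun h => (hj d hd).2.2 c hlt (h.trans ((hj c hc).2.1.trans (hmono ⟨le_rfl, bot_le⟩))))
  refine ⟨g, fun x => ?_⟩
  refine le_antisymm ?_ ?_
  · by_contra! hlt
    have h0 := (bot_le.trans_lt hlt).ne'
    exact (hj _ h0).2.2 x.1 hlt (((hg _ _ h0).1 le_rfl).trans (hmono ⟨le_rfl, le_top⟩))
  · by_cases hx : x.1 = ⊥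
    · exact hx ▸ bot_le
    · exact (hg _ _ hx).2 ((hj _ hx).2.1.trans (hmono ⟨le_rfl, bot_le⟩))

theorem LatticeHom.le_of_map_le_of_injective {A B : Type u} [Lattice A] [Lattice B]
    (ι : LatticeHom A B) (hι : Function.Injective ι) {x y : A} (h : ι x ≤ ι y) : x ≤ y := by
  rw [← inf_eq_left] at h ⊢
  exact hι (by rw [map_inf, h])

theorem IsProductOfTwoNontrivialFiniteChains.exists_retraction {D B : Type u} [DistribLattice D]
    [DistribLattice B] (hD : IsProductOfTwoNontrivialFiniteChains D) (hB : IsPlanarLattice B)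
    (ι : LatticeHom D B) (hι : Function.Injective ι) :
    ∃ f : LatticeHom B D, ∀ a, f (ι a) = a := by
  obtain ⟨C₁, C₂, _, _, _, _, _, _, ⟨e⟩⟩ := hD
  have := Fintype.ofFinite C₁
  have := Fintype.ofFinite C₂
  let : BoundedOrder C₁ := Fintype.toBoundedOrder C₁
  let : BoundedOrder C₂ := Fintype.toBoundedOrder C₂
  have hm : Monotone ι := OrderHomClass.mono ι
  obtain ⟨g₁, h₁⟩ := hB.exists_latticeHom_fst (fun x : C₁ × C₂ => ι (e.symm x))
    (hm.comp e.symm.monotone)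
    fun h => e.symm.le_iff_le.1 (ι.le_of_map_le_of_injective hι h)
  obtain ⟨g₂, h₂⟩ := hB.exists_latticeHom_fst (fun x : C₂ × C₁ => ι (e.symm x.swap))
    (fun x y h => hm (e.symm.monotone (Prod.swap_le_swap.2 h)))
    fun h => Prod.swap_le_swap.1 (e.symm.le_iff_le.1 (ι.le_of_map_le_of_injective hι h))
  refine ⟨⟨⟨fun b => e.symm (g₁ b, g₂ b), fun a b => ?_⟩, fun a b => ?_⟩, fun a => ?_⟩
  · rw [← map_sup, map_sup, map_sup]
    rfl
  · show e.symm (g₁ (a ⊓ b), g₂ (a ⊓ b)) = e.symm _ ⊓ e.symm _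
    rw [← map_inf, map_inf, map_inf]
    rfl
  · show e.symm (g₁ (ι a), g₂ (ι a)) = a
    have h1 := h₁ (e a)
    have h2 := h₂ (e a).swap
    simp only [Prod.swap_swap, e.symm_apply_apply, Prod.fst_swap] at h1 h2
    rw [h1, h2]
    exact e.symm_apply_apply a

theorem exists_retraction_of_card_le_two {D B : Type u} [DistribLattice D] [DistribLattice B]
    [Finite D] [Nonempty D] [Finite B] (hD : Nat.card D ≤ 2) (ι : LatticeHom D B)
    (hι : Function.Injective ι) : ∃ f : LatticeHom B D, ∀ a, f (ι a) = a := by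
  classical
  have := Fintype.ofFinite D
  rcases subsingleton_or_nontrivial D with hs | hn
  · obtain ⟨d⟩ := ‹Nonempty D›
    exact ⟨⟨⟨fun _ => d, fun _ _ => Subsingleton.elim _ _⟩, fun _ _ => Subsingleton.elim _ _⟩,
      fun _ => Subsingleton.elim _ _⟩
  let : BoundedOrder D := Fintype.toBoundedOrder D
  have hall : ∀ a : D, a = ⊥ ∨ a = ⊤ := by
    intro a
    by_contra! h
    have h3 : ({a, ⊥, ⊤} : Finset D).card = 3 := by
      rw [Finset.card_eq_three]
      exact ⟨a, ⊥, ⊤, h.1, h.2, bot_ne_top, rfl⟩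
    have := Finset.card_le_univ ({a, ⊥, ⊤} : Finset D)
    rw [Nat.card_eq_fintype_card] at hD
    omega
  obtain ⟨j, hj, h1, h2⟩ := exists_supPrime_le_not_le (a := ι ⊤) (b := ι ⊥)
    fun h => bot_lt_top.not_ge (ι.le_of_map_le_of_injective hι h)
  refine ⟨⟨⟨fun b => if j ≤ b then ⊤ else ⊥, fun a b => ?_⟩, fun a b => ?_⟩, fun a => ?_⟩
  · by_cases ha : j ≤ a <;> by_cases hb : j ≤ b <;> simp [hj.le_sup, ha, hb]
  · show (if j ≤ a ⊓ b then (⊤ : D) else ⊥) = (if j ≤ a then ⊤ else ⊥) ⊓ if j ≤ b then ⊤ else ⊥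
    by_cases ha : j ≤ a <;> by_cases hb : j ≤ b <;> simp [ha, hb]
  · show (if j ≤ ι a then (⊤ : D) else ⊥) = a
    rcases hall a with rfl | rfl <;> simp [h1, h2]

/-! ### Embedding into a product of two chains -/

/-- The map that sends `d` to the elements of `C` below `d`, where `C` consists of join-prime
elements. -/
def lowerTrace {D : Type u} [DistribLattice D] (C : Set D) (hC : ∀ j ∈ C, SupPrime j) :
    LatticeHom D (LowerSet C) where
  toFun d := ⟨{j | (j : D) ≤ d}, fun _ _ h h' => le_trans h h'⟩
  map_sup' a b := by
    ext j
    exact (hC j j.2).le_sup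
  map_inf' a b := by
    ext j
    exact le_inf_iff

/-- Any two join-primes below `e` but not `d` each join with `d` to `e`, hence lie below each other.
Thus a cover changes only one of the two coordinates of the embedding, and by a single step. -/
theorem exists_supPrime_of_covBy {D : Type u} [DistribLattice D] [Finite D] {d e : D}
    (h : d ⋖ e) : ∃ j, SupPrime j ∧ j ≤ e ∧ ¬ j ≤ d ∧
      ∀ i, SupPrime i → i ≤ e → ¬ i ≤ d → i = j := by
  obtain ⟨j, hj, hje, hjd⟩ := exists_supPrime_le_not_le h.lt.not_ge
  refine ⟨j, hj, hje, hjd, fun i hi hie hid => ?_⟩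
  have key : ∀ k, k ≤ e → ¬ k ≤ d → d ⊔ k = e := fun k hke hkd =>
    (h.eq_or_eq le_sup_left (sup_le h.le hke)).resolve_left fun h => hkd (h ▸ le_sup_right)
  refine le_antisymm ?_ ?_
  · exact (hi.le_sup.1 (hie.trans (key j hje hjd).ge)).resolve_left hid
  · exact (hj.le_sup.1 (hje.trans (key i hie hid).ge)).resolve_left hjd

theorem lowerTrace_covBy {D : Type u} [DistribLattice D] {C : Set D}
    {hC : ∀ j ∈ C, SupPrime j} {d e j : D} (hde : d ≤ e) (hj : j ∈ C) (hje : j ≤ e)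
    (hjd : ¬ j ≤ d) (huniq : ∀ i ∈ C, i ≤ e → ¬ i ≤ d → i = j) :
    lowerTrace C hC d ⋖ lowerTrace C hC e := by
  have hle : lowerTrace C hC d ≤ lowerTrace C hC e := fun i hi => le_trans hi hde
  refine ⟨lt_of_le_not_ge hle fun h => hjd (h (show (⟨j, hj⟩ : C) ∈ lowerTrace C hC e from hje)),
    fun S hS hS' => ?_⟩
  obtain ⟨i, hi, hid⟩ := not_subset.1 (show ¬ (S : Set C) ⊆ lowerTrace C hC d from hS.not_ge)
  have hij : (i : D) = j := huniq i i.2 (hS'.le hi) hid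
  refine hS'.not_ge fun k hk => ?_
  by_cases hkd : (k : D) ≤ d
  · exact hS.le (show k ∈ lowerTrace C hC d from hkd)
  · have : k = i := Subtype.ext ((huniq k k.2 hk hkd).trans hij.symm)
    exact this ▸ hi

theorem lowerTrace_eq {D : Type u} [DistribLattice D] {C : Set D}
    {hC : ∀ j ∈ C, SupPrime j} {d e : D} (hde : d ≤ e) (huniq : ∀ i ∈ C, i ≤ e → i ≤ d) :
    lowerTrace C hC d = lowerTrace C hC e := by
  ext i
  exact ⟨fun h => le_trans h hde, fun h => huniq i i.2 h⟩

/-- The join-prime elements of a planar distributive lattice with more than two elements form the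
union of two disjoint nonempty chains. -/
theorem IsPlanarLattice.exists_two_chains {D : Type u} [DistribLattice D] (hD : IsPlanarLattice D)
    (hcard : ¬ Nat.card D ≤ 2) : ∃ C C' : Set D, C.Nonempty ∧ C'.Nonempty ∧ Disjoint C C' ∧
      C ∪ C' = {j | SupPrime j} ∧ IsChain (· ≤ ·) C ∧ IsChain (· ≤ ·) C' := by
  have := hD.finite
  have hnt : ({j : D | SupPrime j}).Nontrivial := by
    by_contra hs
    rw [not_nontrivial_iff] at hs
    have hle : ∀ d e : D, ((∃ j, SupPrime j ∧ j ≤ d) → ∃ j, SupPrime j ∧ j ≤ e) → d ≤ e := by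
      intro d e h
      by_contra hde
      obtain ⟨j, hj, hjd, hje⟩ := exists_supPrime_le_not_le hde
      obtain ⟨i, hi, hie⟩ := h ⟨j, hj, hjd⟩
      exact hje (hs hi hj ▸ hie)
    -- With at most one join-prime, an element is determined by a single truth value, so there are
    -- at most two elements.
    have hinj : Function.Injective fun d : D => ∃ j, SupPrime j ∧ j ≤ d := fun d e h =>
      le_antisymm (hle d e h.mp) (hle e d h.mpr)
    have := Nat.card_le_card_of_injective _ hinj
    rw [Nat.card_eq_fintype_card (α := Prop), Fintype.card_prop] at this
    exact hcard this
  -- If the join-primes already form a chain, one element is split off so that both parts are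
  -- nonempty and both factors nontrivial.
  by_cases hchain : IsChain (· ≤ ·) {j : D | SupPrime j}
  · obtain ⟨x, hx, y, hy, hxy⟩ := hnt
    exact ⟨{x}, {j | SupPrime j} \ {x}, singleton_nonempty x, ⟨y, hy, hxy.symm⟩,
      disjoint_sdiff_right, union_sdiff_cancel (singleton_subset_iff.2 hx), by simp,
      hchain.mono sdiff_subset⟩
  · obtain ⟨C, hCs, hC, hC'⟩ := exists_isChain_isChain_sdiff
      (toFinite {j : D | SupPrime j}).toFinset fun x hx y hy z hz hxy hyx hxz hzx hyz hzy =>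
        hD.not_supPrime_antichain (by simpa using hx) (by simpa using hy) (by simpa using hz)
          hxy hyx hxz hzx hyz hzy
    have hCs' : (C : Set D) ⊆ {j | SupPrime j} := fun j hj => by simpa using hCs hj
    rw [Finite.coe_toFinset] at hC'
    refine ⟨C, {j | SupPrime j} \ C, ?_, ?_, disjoint_sdiff_right, union_sdiff_cancel hCs', hC, hC'⟩
    · by_contra h
      rw [not_nonempty_iff_eq_empty] at h
      rw [h, sdiff_empty] at hC'
      exact hchain hC'
    · by_contra h
      rw [not_nonempty_iff_eq_empty, sdiff_eq_empty] at h
      exact hchain (hC.mono h)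

theorem nontrivial_lowerSet (C : Type u) [Preorder C] [Nonempty C] : Nontrivial (LowerSet C) :=
  ⟨⊥, ⊤, fun h => h.ge (mem_univ (Classical.arbitrary C))⟩

/-- The linear order of a chain in a partially ordered set. -/
noncomputable abbrev IsChain.toLinearOrder {D : Type u} [PartialOrder D] {C : Set D}
    (hC : IsChain (· ≤ ·) C) : LinearOrder C :=
  { (inferInstance : PartialOrder C) with
    le_total := fun a b => hC.total a.2 b.2
    toDecidableLE := Classical.decRel _ }

theorem IsPlanarLattice.exists_coverPreserving_embedding {D : Type u} [DistribLattice D]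
    (hD : IsPlanarLattice D) (hcard : ¬ Nat.card D ≤ 2) :
    ∃ (C₁ C₂ : Type u) (_ : LinearOrder C₁) (_ : LinearOrder C₂) (ι : LatticeHom D (C₁ × C₂)),
      Finite C₁ ∧ Finite C₂ ∧ Nontrivial C₁ ∧ Nontrivial C₂ ∧ Function.Injective ι ∧
        IsCoverPreservingZeroOneHom ι := by
  have := hD.finite
  obtain ⟨C, C', hne, hne', hdisj, hunion, hC, hC'⟩ := hD.exists_two_chains hcard
  have hP : ∀ j ∈ C, SupPrime j := fun j hj => hunion.subset (Or.inl hj)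
  have hP' : ∀ j ∈ C', SupPrime j := fun j hj => hunion.subset (Or.inr hj)
  have hcover : ∀ j, SupPrime j → j ∈ C ∨ j ∈ C' := fun j hj => hunion.superset hj
  let : LinearOrder C := hC.toLinearOrder
  let : LinearOrder C' := hC'.toLinearOrder
  have := hne.to_subtype
  have := hne'.to_subtype
  let ι : LatticeHom D (LowerSet C × LowerSet C') :=
    { toFun := fun d => (lowerTrace C hP d, lowerTrace C' hP' d)
      map_sup' := fun a b => Prod.ext (map_sup _ a b) (map_sup _ a b)
      map_inf' := fun a b => Prod.ext (map_inf _ a b) (map_inf _ a b) }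
  refine ⟨LowerSet C, LowerSet C', inferInstance, inferInstance, ι,
    Finite.of_injective _ SetLike.coe_injective, Finite.of_injective _ SetLike.coe_injective,
    nontrivial_lowerSet C, nontrivial_lowerSet C', ?_, ?_, ?_, ?_⟩
  · have hle : ∀ d e, ι d = ι e → d ≤ e := by
      intro d e h
      by_contra hde
      obtain ⟨j, hj, hjd, hje⟩ := exists_supPrime_le_not_le hde
      obtain ⟨h1, h2⟩ := Prod.mk.inj h
      rcases hcover j hj with hjC | hjC
      · exact hje (h1.le (show (⟨j, hjC⟩ : C) ∈ lowerTrace C hP d from hjd))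
      · exact hje (h2.le (show (⟨j, hjC⟩ : C') ∈ lowerTrace C' hP' d from hjd))
    exact fun d e h => le_antisymm (hle d e h) (hle e d h.symm)
  · intro a ha S
    have hn : ∀ j, SupPrime j → ¬ j ≤ a := fun j hj h => hj.not_isMin fun b _ => h.trans (ha b)
    exact ⟨fun j hj => absurd hj (hn j (hP j j.2)), fun j hj => absurd hj (hn j (hP' j j.2))⟩
  · intro a ha S
    exact ⟨fun j _ => ha j, fun j _ => ha j⟩
  · intro d e hde
    obtain ⟨j, hj, hje, hjd, huniq⟩ := exists_supPrime_of_covBy hde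
    have aux : ∀ {i}, SupPrime i → i ≠ j → i ≤ e → i ≤ d := fun hi hij hie =>
      by_contra fun hid => hij (huniq _ hi hie hid)
    refine Prod.mk_covBy_mk_iff.2 ?_
    rcases hcover j hj with hjC | hjC
    · exact Or.inl ⟨lowerTrace_covBy hde.le hjC hje hjd fun i hi => huniq i (hP i hi),
        lowerTrace_eq hde.le fun i hi => aux (hP' i hi) fun h =>
          disjoint_left.1 hdisj hjC (h ▸ hi)⟩
    · exact Or.inr ⟨lowerTrace_covBy hde.le hjC hje hjd fun i hi => huniq i (hP' i hi),
        lowerTrace_eq hde.le fun i hi => aux (hP i hi) fun h =>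
          disjoint_left.1 hdisj (h ▸ hi) hjC⟩

/-! ### The cycle of implications -/

theorem corollary1p7 (D : Type u) [DistribLattice D] (hD : IsPlanarLattice D) :
    List.TFAE
      [planarDistLat.IsAbsoluteRetract D,
       planarDistLatCov.IsAbsoluteHRetract D,
       planarDistLatCov.IsAbsoluteRetract D,
       Nat.card D ≤ 2 ∨ IsProductOfTwoNontrivialFiniteChains D] := by
  have := hD.finite
  have := hD.nonempty
  tfae_have 1 → 3 := by
    rintro ⟨-, h⟩
    refine ⟨hD, fun B _ ι ⟨_, hB, hinj, hι⟩ => ?_⟩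
    have := hB.finite
    obtain ⟨f, -, hf⟩ := h B ι ⟨hD, hB, hinj, trivial⟩
    exact ⟨f, .of_orderIso f (ι.orderIsoOfLeftInverse f hf (hι.injective_of_leftInverse hf))
      fun _ => rfl, hf⟩
  tfae_have 3 → 2 := by
    rintro ⟨_, h⟩
    refine ⟨hD, fun B _ ι hι => ?_⟩
    obtain ⟨f, -, hf⟩ := h B ι hι
    exact ⟨f, hf⟩
  tfae_have 2 → 4 := by
    rintro ⟨-, h⟩
    refine or_iff_not_imp_left.2 fun hcard => ?_
    obtain ⟨C₁, C₂, _, _, ι, _, _, _, _, hinj, hι⟩ := hD.exists_coverPreserving_embedding hcard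
    obtain ⟨f, hf⟩ := h (C₁ × C₂) ι ⟨hD, isPlanarLattice_prod C₁ C₂, hinj, hι⟩
    exact ⟨C₁, C₂, inferInstance, inferInstance, inferInstance, inferInstance, inferInstance,
      inferInstance, ⟨(ι.orderIsoOfLeftInverse f hf (hι.injective_of_leftInverse hf)).symm⟩⟩
  tfae_have 4 → 1 := by
    intro h
    refine ⟨hD, fun B _ ι ⟨_, hB, hinj, _⟩ => ?_⟩
    have := hB.finite
    obtain ⟨f, hf⟩ : ∃ f : LatticeHom B D, ∀ a, f (ι a) = a :=
      h.elim (fun h => exists_retraction_of_card_le_two h ι hinj)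
        fun h => h.exists_retraction hB ι hinj
    exact ⟨f, trivial, hf⟩
  tfae_finish
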